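/- Let $\Sigma$ be a finite alphabet and let $\#\notin\Sigma$ be a border symbol. A \emph{picture} over $\Sigma$ is an $m\times n$ array $P=(P_{i,j})_{1\le i\le m,\,1\le j\le n}$ of symbols of $\Sigma$ with $m,n\ge 1$, or the empty picture $\Lambda$, of dimensions $(0,0)$; $\Sigma^{*,*}$ is the set of all pictures. The \emph{boundary picture} $\hat P$ is the $(m+2)\times(n+2)$ array, with rows $0,\dots,m+1$ and columns $0,\dots,n+1$, that is obtained by surrounding $P$ with the symbol $\#$. A (nondeterministic) \emph{two-dimensional online tessellation automaton} (2OTA) over $\Sigma$ consists of a finite set $Q$ of states, an initial state $q_0\in Q$, a set $F\subseteq Q$ of final states and a map $\delta\colon Q\times Q\times\Sigma\to 2^Q$. A run on $P$ assigns to every position $(i,j)$ of $\hat P$ a state $q_{i,j}$ such that $q_{0,j}=q_{i,0}=q_0$ for all $i,j$, and $q_{i,j}\in\delta(q_{i-1,j},q_{i,j-1},P_{i,j})$ for $1\le i\le m$, $1\le j\le n$. The automaton accepts $P$ if there is a run with $q_{m,n}\in F$; $L(M)\subseteq\Sigma^{*,*}$ is the set of pictures that $M$ accepts. A \emph{DAG}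 over an alphabet $\Gamma$ is a finite directed acyclic multigraph $G$ whose vertices are labelled by symbols of $\Gamma$ and in which the incoming and the outgoing edges of each vertex $v$ are listed, each exactly once, in strings $\mathit{in}(v)$ and $\mathit{out}(v)$. A (nondeterministic) \emph{DAG automaton} over $\Gamma$ consists of a finite set $N$ of states and a finite set $R$ of rules, each of which is either of the form $\alpha\xrightarrow{\sigma}\beta$ with $\alpha,\beta\in N^*$ and $\sigma\in\Gamma$, or the empty graph $\varnothing$. It accepts a nonempty DAG $G$ if there is a map $\rho$ from the edges of $G$ to $N$ such that for every vertex $v$, with label $\ell(v)$, the rule $\rho(\mathit{in}(v))\xrightarrow{\ell(v)}\rho(\mathit{out}(v))$ belongs to $R$; it accepts the empty DAG if $\varnothing\in R$. $L(A)$ is the set of connected DAGs that $A$ accepts. For a picture $P\in\Sigma^{*,*}$, let $\mathrm{coo}(\hat P)$ be the DAG over $\Sigma\cup\{\#\}$ whose vertices are the positions of $\hat P$, labelled by their symbols, with one edge from each position to its lower neighbour and one edge to its right neighbour, if these exist. Outgoing edges are ordered as (down, right), and incoming edges as (from the left, from above). Theorem. 2OTA and DAG automata are equivalent with respect to this encoding.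 That is, for every set $L$ of DAGs over $\Sigma\cup\{\#\}$, there is a DAG automaton $A$ over $\Sigma\cup\{\#\}$ with $L=L(A)\cap\{\mathrm{coo}(\hat P): P\in\Sigma^{*,*}\}$ if and only if there is a 2OTA $M$ over $\Sigma$ with $L=\{\mathrm{coo}(\hat P): P\in L(M)\}$. Equivalently, for every picture language $L\subseteq\Sigma^{*,*}$, there is a 2OTA $M$ over $\Sigma$ with $L(M)=L$ if and only if there is a DAG automaton $A$ over $\Sigma\cup\{\#\}$ with $L=\{P\in\Sigma^{*,*}:\mathrm{coo}(\hat P)\in L(A)\}$. -/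

import Mathlib

universe u

namespace PicDAG

/-! ### Pictures and boundary pictures -/

/-- A picture over `Γ` with `rows` rows and `cols` columns. The only picture without cells is the
empty picture, of dimensions `(0, 0)`. Rows are counted from top to bottom and columns from left
to right, from `0`. -/
structure Picture (Γ : Type u) where
  rows : ℕ
  cols : ℕ
  rows_eq_zero_iff : rows = 0 ↔ cols = 0
  cell : Fin rows → Fin cols → Γ

/-- The boundary picture: `P` surrounded on all four sides by the border symbol `#`. The alphabet
`Γ ∪ {#}` is `Option Γ`, and `#` is `none`. In the boundary picture, of dimensions
`(rows + 2, cols + 2)`, the cells of `P` have the indices `1, …, rows` and `1, …, cols`. -/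
def Picture.boundary {Γ : Type u} (P : Picture Γ) : Picture (Option Γ) where
  rows := P.rows + 2
  cols := P.cols + 2
  rows_eq_zero_iff := by simp
  cell i j :=
    if h : (0 < i.val ∧ i.val ≤ P.rows) ∧ (0 < j.val ∧ j.val ≤ P.cols) then
      some (P.cell ⟨i.val - 1, by omega⟩ ⟨j.val - 1, by omega⟩)
    else none

/-! ### Two-dimensional online tessellation automata -/

/-- A nondeterministic two-dimensional online tessellation automaton over the alphabet `Γ`. -/
structure TwoOTA (Γ : Type u) where
  State : Type
  finite_state : Finite State
  init : State
  final : Set State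
  /-- `step qUp qLeft a` is the set of possible states at a cell with symbol `a`, where `qUp` and
  `qLeft` are the states at the positions above it and to its left. -/
  step : State → State → Γ → Set State

/-- A run assigns a state to every position of the boundary picture: the initial state in the first
row and the first column, and states allowed by the transition relation at the cells of `P`. -/
structure TwoOTA.IsRun {Γ : Type u} (M : TwoOTA Γ) (P : Picture Γ)
    (ρ : Fin (P.rows + 2) → Fin (P.cols + 2) → M.State) : Prop where
  first_row : ∀ j, ρ 0 j = M.init
  first_col : ∀ i, ρ i 0 = M.init
  cell : ∀ (i : Fin P.rows) (j : Fin P.cols),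
    ρ i.succ.castSucc j.succ.castSucc ∈
      M.step (ρ i.castSucc.castSucc j.succ.castSucc) (ρ i.succ.castSucc j.castSucc.castSucc)
        (P.cell i j)

/-- `M` accepts `P` if some run has a final state at position `(rows, cols)` of the boundary
picture. This is the bottom-right cell of `P` if `P` is nonempty, and it is the position `(0, 0)`,
which carries the initial state, if `P` is the empty picture. -/
def TwoOTA.Accepts {Γ : Type u} (M : TwoOTA Γ) (P : Picture Γ) : Prop :=
  ∃ ρ : Fin (P.rows + 2) → Fin (P.cols + 2) → M.State,
    M.IsRun P ρ ∧ ρ ⟨P.rows, by omega⟩ ⟨P.cols, by omega⟩ ∈ M.final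

/-- The picture language recognized by `M`. -/
def TwoOTA.language {Γ : Type u} (M : TwoOTA Γ) : Set (Picture Γ) :=
  {P | M.Accepts P}

/-! ### Directed acyclic graphs with ordered edges -/

/-- A finite directed acyclic multigraph with vertices labelled by elements of `Γ`, in which the
incoming and the outgoing edges of each vertex are linearly ordered. -/
structure DAG (Γ : Type u) where
  V : Type
  E : Type
  finite_V : Finite V
  finite_E : Finite E
  label : V → Γ
  src : E → V
  tar : E → V
  inEdges : V → List E
  outEdges : V → List E
  nodup_inEdges : ∀ v, (inEdges v).Nodup
  nodup_outEdges : ∀ v, (outEdges v).Nodup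
  mem_inEdges : ∀ v e, e ∈ inEdges v ↔ tar e = v
  mem_outEdges : ∀ v e, e ∈ outEdges v ↔ src e = v
  acyclic : ∀ v, ¬ Relation.TransGen (fun u w => ∃ e, src e = u ∧ tar e = w) v v

/-- Any two vertices are joined by an undirected path. (The empty graph counts as connected.) -/
def DAG.Connected {Γ : Type u} (G : DAG Γ) : Prop :=
  ∀ v w : G.V, Relation.EqvGen (fun u w => ∃ e, G.src e = u ∧ G.tar e = w) v w

/-! ### DAG automata -/

/-- A rule is either of the form `head --symbol--> tail` or the empty graph. -/
inductive DAGRule (Q : Type) (Γ : Type u) : Type u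
  | vertex (head : List Q) (symbol : Γ) (tail : List Q) : DAGRule Q Γ
  | emptyGraph : DAGRule Q Γ

/-- A (nondeterministic) DAG automaton over the alphabet `Γ`. -/
structure DAGAutomaton (Γ : Type u) where
  State : Type
  finite_state : Finite State
  rules : Set (DAGRule State Γ)
  finite_rules : rules.Finite

/-- A run assigns states to the edges so that at each vertex the states of the incoming edges, the
label and the states of the outgoing edges form a rule. -/
def DAGAutomaton.IsRun {Γ : Type u} (A : DAGAutomaton Γ) (G : DAG Γ) (ρ : G.E → A.State) : Prop :=
  ∀ v, DAGRule.vertex ((G.inEdges v).map ρ) (G.label v) ((G.outEdges v).map ρ) ∈ A.rules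

/-- A nonempty DAG is accepted if there is a run on it, and the empty DAG is accepted if the empty
graph is a rule. -/
def DAGAutomaton.Accepts {Γ : Type u} (A : DAGAutomaton Γ) (G : DAG Γ) : Prop :=
  (Nonempty G.V ∧ ∃ ρ : G.E → A.State, A.IsRun G ρ) ∨ (IsEmpty G.V ∧ DAGRule.emptyGraph ∈ A.rules)

/-- The DAG language recognized by `A`: the connected DAGs that it accepts. -/
def DAGAutomaton.language {Γ : Type u} (A : DAGAutomaton Γ) : Set (DAG Γ) :=
  {G | A.Accepts G ∧ G.Connected}

/-! ### The grid encoding -/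

/-- The edges of the `m × n` grid: `Sum.inl v` is the edge from `v` to its lower neighbour, and
`Sum.inr v` is the edge from `v` to its right neighbour. -/
abbrev GridEdge (m n : ℕ) : Type :=
  {v : Fin m × Fin n // v.1.val + 1 < m} ⊕ {v : Fin m × Fin n // v.2.val + 1 < n}

def GridEdge.src {m n : ℕ} : GridEdge m n → Fin m × Fin n
  | Sum.inl v => v.val
  | Sum.inr v => v.val

def GridEdge.tar {m n : ℕ} : GridEdge m n → Fin m × Fin n
  | Sum.inl v => (⟨v.val.1.val + 1, v.property⟩, v.val.2)
  | Sum.inr v => (v.val.1, ⟨v.val.2.val + 1, v.property⟩)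

/-- The incoming edges: first the one from the left neighbour, then the one from above. -/
def gridIn {m n : ℕ} (v : Fin m × Fin n) : List (GridEdge m n) :=
  (if h : 0 < v.2.val then
    [Sum.inr ⟨(v.1, ⟨v.2.val - 1, by omega⟩), by change v.2.val - 1 + 1 < n; omega⟩] else []) ++
  (if h : 0 < v.1.val then
    [Sum.inl ⟨(⟨v.1.val - 1, by omega⟩, v.2), by change v.1.val - 1 + 1 < m; omega⟩] else [])

/-- The outgoing edges: first the one to the lower neighbour, then the one to the right. -/
def gridOut {m n : ℕ} (v : Fin m × Fin n) : List (GridEdge m n) :=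
  (if h : v.1.val + 1 < m then [Sum.inl ⟨v, h⟩] else []) ++
  (if h : v.2.val + 1 < n then [Sum.inr ⟨v, h⟩] else [])

theorem nodup_gridIn {m n : ℕ} (v : Fin m × Fin n) : (gridIn v).Nodup := by
  unfold gridIn
  split_ifs <;> simp

theorem nodup_gridOut {m n : ℕ} (v : Fin m × Fin n) : (gridOut v).Nodup := by
  unfold gridOut
  split_ifs <;> simp

theorem mem_gridOut {m n : ℕ} (v : Fin m × Fin n) (e : GridEdge m n) :
    e ∈ gridOut v ↔ e.src = v := by
  rcases e with ⟨w, hw⟩ | ⟨w, hw⟩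
  all_goals
    simp only [gridOut, GridEdge.src]
    constructor
    · intro h
      split_ifs at h <;> simp_all
    · rintro rfl
      simp [hw]

theorem mem_gridIn {m n : ℕ} (v : Fin m × Fin n) (e : GridEdge m n) :
    e ∈ gridIn v ↔ e.tar = v := by
  obtain ⟨⟨a, ha⟩, ⟨b, hb⟩⟩ := v
  rcases e with ⟨⟨⟨c, hc⟩, ⟨d, hd⟩⟩, hw⟩ | ⟨⟨⟨c, hc⟩, ⟨d, hd⟩⟩, hw⟩
  all_goals
    simp only [gridIn, GridEdge.tar]
    split_ifs <;> simp <;> omega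

theorem GridEdge.sum_lt {m n : ℕ} (e : GridEdge m n) :
    e.src.1.val + e.src.2.val < e.tar.1.val + e.tar.2.val := by
  rcases e with ⟨w, hw⟩ | ⟨w, hw⟩ <;> simp only [GridEdge.src, GridEdge.tar] <;> omega

theorem grid_acyclic {m n : ℕ} (v : Fin m × Fin n) :
    ¬ Relation.TransGen (fun u w => ∃ e : GridEdge m n, e.src = u ∧ e.tar = w) v v := by
  have key : ∀ u w : Fin m × Fin n,
      Relation.TransGen (fun u w => ∃ e : GridEdge m n, e.src = u ∧ e.tar = w) u w →
        u.1.val + u.2.val < w.1.val + w.2.val := by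
    intro u w h
    induction h with
    | single h =>
      obtain ⟨e, rfl, rfl⟩ := h
      exact e.sum_lt
    | tail _ h ih =>
      obtain ⟨e, rfl, rfl⟩ := h
      exact ih.trans e.sum_lt
  exact fun h => lt_irrefl _ (key v v h)

/-- The grid encoding of a picture (with or without boundary): the vertices are the positions,
labelled by their symbols, and each one points to its lower and to its right neighbour. -/
def cooDAG {Γ : Type u} (P : Picture Γ) : DAG Γ where
  V := Fin P.rows × Fin P.cols
  E := GridEdge P.rows P.cols
  finite_V := inferInstance
  finite_E := inferInstance
  label v := P.cell v.1 v.2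
  src := GridEdge.src
  tar := GridEdge.tar
  inEdges := gridIn
  outEdges := gridOut
  nodup_inEdges := nodup_gridIn
  nodup_outEdges := nodup_gridOut
  mem_inEdges := mem_gridIn
  mem_outEdges := mem_gridOut
  acyclic := grid_acyclic

/-- The encoding of pictures over `Γ` by the grids of their boundary pictures. -/
def cooEnc {Γ : Type u} (P : Picture Γ) : DAG (Option Γ) :=
  cooDAG P.boundary

/-! ### Equivalence with respect to a picture-to-DAG encoding -/

/-- A family `𝒜` of DAG automata and a family `ℳ` of picture automata are equivalent with respect
to the encoding `enc` if the languages `L(A) ∩ enc(Γ**)` with `A ∈ 𝒜` are exactly the languages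
`enc(L(M))` with `M ∈ ℳ`. -/
def FamiliesEquivalent {Γ : Type u} (enc : Picture Γ → DAG (Option Γ))
    (𝒜 : Set (DAGAutomaton (Option Γ))) (ℳ : Set (TwoOTA Γ)) : Prop :=
  ∀ L : Set (DAG (Option Γ)),
    (∃ A ∈ 𝒜, A.language ∩ Set.range enc = L) ↔ (∃ M ∈ ℳ, enc '' M.language = L)

end PicDAG

/-! Both kinds of automata check local conditions on a grid, one with states on edges and the other
with states on vertices. Each simulates the other once the border is taken care of.

From a 2OTA to a DAG automaton, every edge carries the state of its source. The degrees of a `#`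
vertex separate neither the top from the left side nor the bottom from the right side, so one rule
must serve both. Vertices of the top and left sides emit the initial state; those of the bottom and
right sides pass on the state from above. This brings the state of the last cell to the bottom-right
corner, which tests whether it is final (`TwoOTA.IsGridRun.exists_gridRun`,
`TwoOTA.exists_isGridRun`).

Conversely, a 2OTA makes transitions at cells only, so the cells must also check the rules at the
`#` vertices. A cell guesses the states on its own edges and on the border edges at the ends of its
row and column, and neighbouring cells must agree on shared edges. The first row and column are
recognized by the initial state `none`, which no transition produces. The last ones are guessed by
flags, constant along a row or a column, and a final window has both flags set
(`DAGAutomaton.exists_isGridRun_toTwoOTA`, `DAGAutomaton.exists_gridRun`). The empty picture has no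
cells and is settled by the finality of `none`. -/

namespace PicDAG

/-! ### Runs indexed by natural numbers -/

/-- The symbol of the boundary picture at the position `(i, j)`. -/
def Picture.boundaryLabel {Γ : Type u} (P : Picture Γ) (i j : ℕ) : Option Γ :=
  if h : (0 < i ∧ i ≤ P.rows) ∧ (0 < j ∧ j ≤ P.cols) then
    some (P.cell ⟨i - 1, by omega⟩ ⟨j - 1, by omega⟩)
  else none

theorem Picture.boundaryLabel_succ {Γ : Type u} (P : Picture Γ) {i j : ℕ} (hi : i < P.rows)
    (hj : j < P.cols) : P.boundaryLabel (i + 1) (j + 1) = some (P.cell ⟨i, hi⟩ ⟨j, hj⟩) := by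
  have h : (0 < i + 1 ∧ i + 1 ≤ P.rows) ∧ (0 < j + 1 ∧ j + 1 ≤ P.cols) := by omega
  simp [boundaryLabel, h]

theorem Picture.boundaryLabel_border {Γ : Type u} (P : Picture Γ) {i j : ℕ}
    (h : i = 0 ∨ j = 0 ∨ P.rows < i ∨ P.cols < j) : P.boundaryLabel i j = none :=
  dif_neg (by omega)

/-- The states on the incoming edges of `(i, j)`, where `h i j` and `v i j` are the states on the
edges from `(i, j)` to its right and to its lower neighbour. -/
def inWord {Q : Type} (h v : ℕ → ℕ → Q) (i j : ℕ) : List Q :=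
  (if 0 < j then [h i (j - 1)] else []) ++ (if 0 < i then [v (i - 1) j] else [])

/-- The states on the outgoing edges of `(i, j)` in an `m × n` grid. -/
def outWord {Q : Type} (h v : ℕ → ℕ → Q) (m n i j : ℕ) : List Q :=
  (if i + 1 < m then [v i j] else []) ++ (if j + 1 < n then [h i j] else [])

/-- A run on the encoding of `P` of a DAG automaton with the rules `R`, given by the states `h i j`
and `v i j` on the edges from `(i, j)` to its right and to its lower neighbour. -/
structure IsGridRun {Γ : Type u} {Q : Type} (R : List Q → Option Γ → List Q → Prop)
    (P : Picture Γ) (h v : ℕ → ℕ → Q) : Prop where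
  top_left : R [] none [v 0 0, h 0 0]
  top : ∀ j, j < P.cols → R [h 0 j] none [v 0 (j + 1), h 0 (j + 1)]
  top_right : R [h 0 P.cols] none [v 0 (P.cols + 1)]
  left : ∀ i, i < P.rows → R [v i 0] none [v (i + 1) 0, h (i + 1) 0]
  cell : ∀ (i j : ℕ) (hi : i < P.rows) (hj : j < P.cols),
    R [h (i + 1) j, v i (j + 1)] (some (P.cell ⟨i, hi⟩ ⟨j, hj⟩))
      [v (i + 1) (j + 1), h (i + 1) (j + 1)]
  right : ∀ i, i < P.rows →
    R [h (i + 1) P.cols, v i (P.cols + 1)] none [v (i + 1) (P.cols + 1)]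
  bottom_left : R [v P.rows 0] none [h (P.rows + 1) 0]
  bottom : ∀ j, j < P.cols →
    R [h (P.rows + 1) j, v P.rows (j + 1)] none [h (P.rows + 1) (j + 1)]
  bottom_right : R [h (P.rows + 1) P.cols, v P.rows (P.cols + 1)] none []

/-- The boundary picture has at least two rows and two columns, so its four corners are distinct
even for the empty picture, and each position falls under exactly one of the nine cases. -/
theorem isGridRun_iff {Γ : Type u} {Q : Type} (R : List Q → Option Γ → List Q → Prop)
    (P : Picture Γ) (h v : ℕ → ℕ → Q) :
    IsGridRun R P h v ↔ ∀ i j, i < P.rows + 2 → j < P.cols + 2 →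
      R (inWord h v i j) (P.boundaryLabel i j) (outWord h v (P.rows + 2) (P.cols + 2) i j) := by
  unfold inWord outWord
  constructor
  · intro H i j hi hj
    rcases i with _ | i <;> rcases j with _ | j
    · simpa [P.boundaryLabel_border] using H.top_left
    · rcases (show j < P.cols ∨ j = P.cols by omega) with h | rfl
      · simpa [P.boundaryLabel_border, h] using H.top j h
      · simpa [P.boundaryLabel_border] using H.top_right
    · rcases (show i < P.rows ∨ i = P.rows by omega) with h | rfl
      · simpa [P.boundaryLabel_border, h] using H.left i h
      · simpa [P.boundaryLabel_border] using H.bottom_left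
    · rcases (show j < P.cols ∨ j = P.cols by omega) with h | rfl <;>
        rcases (show i < P.rows ∨ i = P.rows by omega) with h' | rfl
      · simpa [P.boundaryLabel_succ h' h, h, h'] using H.cell i j h' h
      · simpa [P.boundaryLabel_border, h] using H.bottom j h
      · simpa [P.boundaryLabel_border, h'] using H.right i h'
      · simpa [P.boundaryLabel_border] using H.bottom_right
  · intro H
    refine ⟨?_, fun j hj => ?_, ?_, fun i hi => ?_, fun i j hi hj => ?_, fun i hi => ?_, ?_,
      fun j hj => ?_, ?_⟩
    · simpa [P.boundaryLabel_border] using H 0 0 (by omega) (by omega)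
    · simpa [P.boundaryLabel_border, hj] using H 0 (j + 1) (by omega) (by omega)
    · simpa [P.boundaryLabel_border] using H 0 (P.cols + 1) (by omega) (by omega)
    · simpa [P.boundaryLabel_border, hi] using H (i + 1) 0 (by omega) (by omega)
    · simpa [P.boundaryLabel_succ hi hj, hi, hj] using H (i + 1) (j + 1) (by omega) (by omega)
    · simpa [P.boundaryLabel_border, hi] using H (i + 1) (P.cols + 1) (by omega) (by omega)
    · simpa [P.boundaryLabel_border] using H (P.rows + 1) 0 (by omega) (by omega)
    · simpa [P.boundaryLabel_border, hj] using H (P.rows + 1) (j + 1) (by omega) (by omega)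
    · simpa [P.boundaryLabel_border] using H (P.rows + 1) (P.cols + 1) (by omega) (by omega)

/-- The words and symbols that form a rule of `A`. -/
def DAGAutomaton.HasRule {Γ : Type u} (A : DAGAutomaton Γ) (s : List A.State) (a : Γ)
    (t : List A.State) : Prop :=
  DAGRule.vertex s a t ∈ A.rules

theorem map_gridIn {Q : Type} {m n : ℕ} (h v : ℕ → ℕ → Q) (ρ : GridEdge m n → Q)
    (hl : ∀ w, ρ (Sum.inl w) = v w.1.1 w.1.2) (hr : ∀ w, ρ (Sum.inr w) = h w.1.1 w.1.2)
    (x : Fin m × Fin n) : (gridIn x).map ρ = inWord h v x.1 x.2 := by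
  unfold gridIn inWord
  split_ifs <;> simp [hl, hr]

theorem map_gridOut {Q : Type} {m n : ℕ} (h v : ℕ → ℕ → Q) (ρ : GridEdge m n → Q)
    (hl : ∀ w, ρ (Sum.inl w) = v w.1.1 w.1.2) (hr : ∀ w, ρ (Sum.inr w) = h w.1.1 w.1.2)
    (x : Fin m × Fin n) : (gridOut x).map ρ = outWord h v m n x.1 x.2 := by
  unfold gridOut outWord
  split_ifs <;> simp [hl, hr]

theorem DAGAutomaton.isRun_cooEnc_iff {Γ : Type u} (A : DAGAutomaton (Option Γ)) (P : Picture Γ)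
    (h v : ℕ → ℕ → A.State) (ρ : GridEdge (P.rows + 2) (P.cols + 2) → A.State)
    (hl : ∀ w, ρ (Sum.inl w) = v w.1.1 w.1.2) (hr : ∀ w, ρ (Sum.inr w) = h w.1.1 w.1.2) :
    A.IsRun (cooEnc P) ρ ↔ IsGridRun A.HasRule P h v := by
  have key : ∀ x : Fin (P.rows + 2) × Fin (P.cols + 2),
      A.HasRule (((cooEnc P).inEdges x).map ρ) ((cooEnc P).label x)
        (((cooEnc P).outEdges x).map ρ) ↔
      A.HasRule (inWord h v x.1 x.2) (P.boundaryLabel x.1 x.2)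
        (outWord h v (P.rows + 2) (P.cols + 2) x.1 x.2) := fun x =>
    iff_of_eq (congrArg₂ (fun a b => A.HasRule a (P.boundaryLabel x.1 x.2) b)
      (map_gridIn h v ρ hl hr x) (map_gridOut h v ρ hl hr x))
  rw [isGridRun_iff]
  exact ⟨fun H i j hi hj => (key (⟨i, hi⟩, ⟨j, hj⟩)).1 (H _),
    fun H x => (key x).2 (H _ _ x.1.2 x.2.2)⟩

theorem DAGAutomaton.accepts_cooEnc_iff {Γ : Type u} (A : DAGAutomaton (Option Γ))
    (P : Picture Γ) : A.Accepts (cooEnc P) ↔ ∃ h v, IsGridRun A.HasRule P h v := by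
  have x₀ : (cooEnc P).V := ((0, 0) : Fin (P.rows + 2) × Fin (P.cols + 2))
  constructor
  · rintro (⟨-, ρ, hρ⟩ | ⟨he, -⟩)
    · change GridEdge (P.rows + 2) (P.cols + 2) → A.State at ρ
      -- `A.State` might be empty a priori, but the grid has an edge down from `(0, 0)`, whose state
      -- serves as default.
      let d : A.State := ρ (Sum.inl ⟨(0, 0), by simp⟩)
      refine ⟨fun i j => if H : i < P.rows + 2 ∧ j + 1 < P.cols + 2 then
          ρ (Sum.inr ⟨((⟨i, H.1⟩ : Fin (P.rows + 2)), (⟨j, by omega⟩ : Fin (P.cols + 2))), H.2⟩)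
          else d,
        fun i j => if H : i + 1 < P.rows + 2 ∧ j < P.cols + 2 then
          ρ (Sum.inl ⟨((⟨i, by omega⟩ : Fin (P.rows + 2)), (⟨j, H.2⟩ : Fin (P.cols + 2))), H.1⟩)
          else d,
        (A.isRun_cooEnc_iff P _ _ ρ ?_ ?_).1 hρ⟩
      · rintro ⟨⟨⟨i, hi⟩, ⟨j, hj⟩⟩, hw⟩
        rw [dif_pos ⟨hw, hj⟩]
      · rintro ⟨⟨⟨i, hi⟩, ⟨j, hj⟩⟩, hw⟩
        rw [dif_pos ⟨hi, hw⟩]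
    · exact (he.false x₀).elim
  · rintro ⟨h, v, hA⟩
    exact Or.inl ⟨⟨x₀⟩, Sum.elim (fun w => v w.1.1 w.1.2) (fun w => h w.1.1 w.1.2),
      (A.isRun_cooEnc_iff P h v _ (fun _ => rfl) (fun _ => rfl)).2 hA⟩

/-- Each position other than `(0, 0)` has an incoming edge from a position with smaller coordinate
sum. Hence connectedness is no restriction on encodings. -/
theorem cooEnc_connected {Γ : Type u} (P : Picture Γ) : (cooEnc P).Connected := by
  have key : ∀ k : ℕ, ∀ x : Fin (P.rows + 2) × Fin (P.cols + 2), x.1.val + x.2.val = k →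
      Relation.EqvGen (fun u w => ∃ e : GridEdge (P.rows + 2) (P.cols + 2), e.src = u ∧ e.tar = w)
        (0, 0) x := by
    intro k
    induction k with
    | zero =>
      rintro ⟨⟨i, hi⟩, ⟨j, hj⟩⟩ h
      obtain ⟨rfl, rfl⟩ : i = 0 ∧ j = 0 := by simpa using h
      exact Relation.EqvGen.refl _
    | succ k ih =>
      rintro ⟨⟨i, hi⟩, ⟨j, hj⟩⟩ h
      rcases i with _ | i
      · rcases j with _ | j
        · simp at h
        · exact (ih (⟨0, hi⟩, ⟨j, by omega⟩) (by simp at h ⊢; omega)).trans _ _ _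
            (Relation.EqvGen.rel _ _ ⟨Sum.inr ⟨(⟨0, hi⟩, ⟨j, by omega⟩), hj⟩, rfl, rfl⟩)
      · exact (ih (⟨i, by omega⟩, ⟨j, hj⟩) (by simp at h ⊢; omega)).trans _ _ _
          (Relation.EqvGen.rel _ _ ⟨Sum.inl ⟨(⟨i, by omega⟩, ⟨j, hj⟩), hi⟩, rfl, rfl⟩)
  intro x y
  exact ((key _ x rfl).symm).trans _ _ _ (key _ y rfl)

theorem DAGAutomaton.cooEnc_mem_language_iff {Γ : Type u} (A : DAGAutomaton (Option Γ))
    (P : Picture Γ) : cooEnc P ∈ A.language ↔ ∃ h v, IsGridRun A.HasRule P h v := by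
  rw [← A.accepts_cooEnc_iff]
  exact and_iff_left (cooEnc_connected P)

/-- A run of a 2OTA, with the positions given by natural numbers. -/
structure TwoOTA.IsGridRun {Γ : Type u} (M : TwoOTA Γ) (P : Picture Γ) (q : ℕ → ℕ → M.State) :
    Prop where
  first_row : ∀ j, q 0 j = M.init
  first_col : ∀ i, q i 0 = M.init
  cell : ∀ (i j : ℕ) (hi : i < P.rows) (hj : j < P.cols),
    q (i + 1) (j + 1) ∈ M.step (q i (j + 1)) (q (i + 1) j) (P.cell ⟨i, hi⟩ ⟨j, hj⟩)
  final : q P.rows P.cols ∈ M.final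

theorem TwoOTA.accepts_iff {Γ : Type u} (M : TwoOTA Γ) (P : Picture Γ) :
    M.Accepts P ↔ ∃ q, M.IsGridRun P q := by
  constructor
  · rintro ⟨ρ, hρ, hf⟩
    have key : ∀ i j (hi : i < P.rows + 2) (hj : j < P.cols + 2),
        (if H : i < P.rows + 2 ∧ j < P.cols + 2 then ρ ⟨i, H.1⟩ ⟨j, H.2⟩ else M.init) =
          ρ ⟨i, hi⟩ ⟨j, hj⟩ := fun i j hi hj => dif_pos ⟨hi, hj⟩
    refine ⟨fun i j => if H : i < P.rows + 2 ∧ j < P.cols + 2 then ρ ⟨i, H.1⟩ ⟨j, H.2⟩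
      else M.init, ?_, ?_, ?_, ?_⟩
    · intro j
      split_ifs with H
      · exact hρ.first_row _
      · rfl
    · intro i
      split_ifs with H
      · exact hρ.first_col _
      · rfl
    · intro i j hi hj
      rw [key (i + 1) (j + 1) (by omega) (by omega), key i (j + 1) (by omega) (by omega),
        key (i + 1) j (by omega) (by omega)]
      exact hρ.cell ⟨i, hi⟩ ⟨j, hj⟩
    · rwa [key P.rows P.cols (by omega) (by omega)]
  · rintro ⟨q, hq⟩
    exact ⟨fun i j => q i j, ⟨fun j => hq.first_row j, fun i => hq.first_col i,
      fun i j => hq.cell i j i.2 j.2⟩, hq.final⟩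

/-! ### From 2OTA to DAG automata -/

/-- The rules of the DAG automaton that simulates `M`. The edges carry the state of their source;
the vertices of the last row repeat the states of the vertices above them. -/
inductive TwoOTA.GridRule {Γ : Type u} (M : TwoOTA Γ) :
    List M.State → Option Γ → List M.State → Prop
  | origin : GridRule M [] none [M.init, M.init]
  | edge (x : M.State) : GridRule M [x] none [M.init, M.init]
  | corner (x : M.State) : GridRule M [x] none [M.init]
  | copy (x y : M.State) : GridRule M [x, y] none [y]
  | accept (x y : M.State) (h : x ∈ M.final) : GridRule M [x, y] none []
  | step (x y z : M.State) (a : Γ) (h : z ∈ M.step y x a) : GridRule M [x, y] (some a) [z, z]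

/-- The DAG automaton that simulates the 2OTA `M` on the encodings of pictures. -/
def TwoOTA.toDAGAutomaton {Γ : Type u} [Finite Γ] (M : TwoOTA Γ) : DAGAutomaton (Option Γ) where
  State := M.State
  finite_state := M.finite_state
  rules := {r | ∃ s a t, r = DAGRule.vertex s a t ∧ M.GridRule s a t}
  finite_rules := by
    have := M.finite_state
    -- No rule has more than two states on either side, and `Γ` is finite.
    have hfin : {l : List M.State | l.length ≤ 2}.Finite := List.finite_length_le _ _
    refine ((hfin.prod ((Set.finite_univ (α := Option Γ)).prod hfin)).image
      (fun p => DAGRule.vertex p.1 p.2.1 p.2.2)).subset ?_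
    rintro r ⟨s, a, t, rfl, h⟩
    refine ⟨(s, a, t), ?_, rfl⟩
    cases h <;> simp

theorem TwoOTA.hasRule_toDAGAutomaton {Γ : Type u} [Finite Γ] (M : TwoOTA Γ) :
    M.toDAGAutomaton.HasRule = M.GridRule := by
  ext s a t
  constructor
  · rintro ⟨s', a', t', h, H⟩
    cases h
    exact H
  · exact fun H => ⟨s, a, t, rfl, H⟩

theorem TwoOTA.IsGridRun.exists_gridRun {Γ : Type u} {M : TwoOTA Γ} {P : Picture Γ}
    {q : ℕ → ℕ → M.State} (hq : M.IsGridRun P q) : ∃ h v, PicDAG.IsGridRun M.GridRule P h v := by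
  -- The minimum makes the bottom border repeat the row above it. The right border carries the
  -- initial state, which its top corner emits and `copy` hands down.
  let f : ℕ → ℕ → M.State := fun i j =>
    if j = P.cols + 1 then M.init else q (min i P.rows) j
  have f_zero : ∀ j, f 0 j = M.init := fun j => by
    simp only [f, Nat.zero_min, hq.first_row, ite_self]
  have f_col : ∀ i, f i 0 = M.init := fun i => by
    simp only [f, hq.first_col, ite_self]
  have f_cell : ∀ i j, i ≤ P.rows → j ≤ P.cols → f i j = q i j := fun i j hi hj => by
    simp only [f, min_eq_left hi]
    rw [if_neg (by omega)]
  have f_last_col : ∀ i, f i (P.cols + 1) = M.init := fun i => by simp [f]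
  have f_last_row : ∀ j, f (P.rows + 1) j = f P.rows j := fun j => by simp [f]
  refine ⟨f, f, ?_, fun j _ => ?_, ?_, fun i _ => ?_, fun i j hi hj => ?_, fun i _ => ?_, ?_,
    fun j _ => ?_, ?_⟩
  · rw [f_zero]
    exact GridRule.origin
  · rw [f_zero, f_zero]
    exact GridRule.edge _
  · rw [f_zero, f_zero]
    exact GridRule.corner _
  · rw [f_col, f_col]
    exact GridRule.edge _
  · refine GridRule.step _ _ _ _ ?_
    rw [f_cell (i + 1) (j + 1) hi hj, f_cell i (j + 1) hi.le hj, f_cell (i + 1) j hi hj.le]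
    exact hq.cell i j hi hj
  · rw [f_last_col, f_last_col]
    exact GridRule.copy _ _
  · rw [f_col, f_col]
    exact GridRule.corner _
  · rw [f_last_row (j + 1)]
    exact GridRule.copy _ _
  · refine GridRule.accept _ _ ?_
    rw [f_last_row, f_cell _ _ le_rfl le_rfl]
    exact hq.final

/-- Degrees and label determine the applicable rules up to the choice of states, so inverting the
rules shows that the vertical edges carry a run of `M`. -/
theorem TwoOTA.exists_isGridRun {Γ : Type u} {M : TwoOTA Γ} {P : Picture Γ}
    {h v : ℕ → ℕ → M.State} (H : PicDAG.IsGridRun M.GridRule P h v) : ∃ q, M.IsGridRun P q := by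
  -- The bound on the length covers `origin` and `edge` together.
  have edge : ∀ {l : List M.State} {x y}, l.length ≤ 1 → M.GridRule l none [x, y] →
      x = M.init := by
    rintro l x y hl (_ | _ | _ | _ | _ | _) <;> rfl
  have corner : ∀ {x y}, M.GridRule [x] none [y] → y = M.init := by
    rintro x y (_ | _ | _ | _ | _ | _); rfl
  have copy : ∀ {x y z}, M.GridRule [x, y] none [z] → z = y := by
    rintro x y z (_ | _ | _ | _ | _ | _); rfl
  have accept : ∀ {x y}, M.GridRule [x, y] none [] → x ∈ M.final := by
    rintro x y (_ | _ | _ | _ | ⟨_, _, hx⟩ | _); exact hx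
  have step : ∀ {x y z w a}, M.GridRule [x, y] (some a) [z, w] → w = z ∧ z ∈ M.step y x a := by
    rintro x y z w a (_ | _ | _ | _ | _ | ⟨_, _, _, _, hx⟩); exact ⟨rfl, hx⟩
  have v_zero : ∀ j, j ≤ P.cols → v 0 j = M.init := by
    rintro (_ | j) hj
    · exact edge (by simp) H.top_left
    · exact edge (by simp) (H.top j hj)
  have v_col : ∀ i, i ≤ P.rows → v i 0 = M.init := by
    rintro (_ | i) hi
    · exact edge (by simp) H.top_left
    · exact edge (by simp) (H.left i hi)
  have h_eq : ∀ i j, i < P.rows → j ≤ P.cols → h (i + 1) j = v (i + 1) j := by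
    rintro i (_ | j) hi hj
    · have := H.left i hi
      -- Case analysis on the rule needs variables as indices.
      generalize h (i + 1) 0 = y, v (i + 1) 0 = x at this ⊢
      rcases this
      rfl
    · exact (step (H.cell i j hi hj)).1
  -- Row `0` and column `0` must be initial at all indices, also outside the grid, where `v` is
  -- arbitrary.
  let q : ℕ → ℕ → M.State := fun i j => if i ≤ P.rows ∧ j ≤ P.cols then v i j else M.init
  have q_eq : ∀ i j, i ≤ P.rows → j ≤ P.cols → q i j = v i j := fun i j hi hj => if_pos ⟨hi, hj⟩
  refine ⟨q, fun j => ?_, fun i => ?_, fun i j hi hj => ?_, ?_⟩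
  · simp only [q]
    split_ifs with hj
    · exact v_zero j hj.2
    · rfl
  · simp only [q]
    split_ifs with hi
    · exact v_col i hi.1
    · rfl
  · rw [q_eq (i + 1) (j + 1) hi hj, q_eq i (j + 1) hi.le hj, q_eq (i + 1) j hi hj.le,
      ← h_eq i j hi hj.le]
    exact (step (H.cell i j hi hj)).2
  · rw [q_eq _ _ le_rfl le_rfl]
    have hf := accept H.bottom_right
    -- The left neighbour of the bottom-right corner is the bottom-left corner if there are no
    -- columns, and it emits the initial state. Otherwise it repeats the state of the last cell.
    rcases Nat.eq_zero_or_pos P.cols with hn | hn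
    · rw [hn] at hf ⊢
      rwa [v_col _ le_rfl, ← corner H.bottom_left]
    · obtain ⟨j, hj⟩ := Nat.exists_eq_add_of_lt hn
      rw [zero_add] at hj
      rw [hj] at hf ⊢
      rwa [← copy (H.bottom j (by omega))]

theorem TwoOTA.cooEnc_mem_toDAGAutomaton_language_iff {Γ : Type u} [Finite Γ] (M : TwoOTA Γ)
    (P : Picture Γ) : cooEnc P ∈ M.toDAGAutomaton.language ↔ P ∈ M.language := by
  rw [DAGAutomaton.cooEnc_mem_language_iff, hasRule_toDAGAutomaton]
  refine Iff.trans ⟨?_, ?_⟩ (M.accepts_iff P).symm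
  · rintro ⟨h, v, H⟩
    exact exists_isGridRun H
  · rintro ⟨q, hq⟩
    exact hq.exists_gridRun

/-! ### From DAG automata to 2OTA -/

/-- The states on the twelve edges of a `3 × 3` grid, and whether its last row and its last column
are in use. The vertex in the centre simulates a cell of the picture. The other vertices simulate
the vertices at the border of the boundary picture, with the first row and column in use at the
cells of the first row and column. -/
structure Window (Q : Type) where
  topIn : Q
  topOut : Q
  cellLeft : Q
  cellRight : Q
  bottomIn : Q
  bottomOut : Q
  leftIn : Q
  leftOut : Q
  cellUp : Q
  cellDown : Q
  rightIn : Q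
  rightOut : Q
  lastRow : Bool
  lastCol : Bool

theorem Window.finite {Q : Type} [Finite Q] : Finite (Window Q) := by
  refine Finite.of_injective (β := (Q × Q × Q × Q × Q × Q) × (Q × Q × Q × Q × Q × Q) × Bool × Bool)
    (fun w => ((w.topIn, w.topOut, w.cellLeft, w.cellRight, w.bottomIn, w.bottomOut),
      (w.leftIn, w.leftOut, w.cellUp, w.cellDown, w.rightIn, w.rightOut), w.lastRow, w.lastCol)) ?_
  rintro ⟨⟩ ⟨⟩ h
  simp only [Prod.mk.injEq] at h
  obtain ⟨⟨rfl, rfl, rfl, rfl, rfl, rfl⟩, ⟨rfl, rfl, rfl, rfl, rfl, rfl⟩, rfl, rfl⟩ := h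
  rfl

/-- The transitions of the 2OTA that simulates the rules `R`. -/
structure Window.IsStep {Γ : Type u} {Q : Type} (R : List Q → Option Γ → List Q → Prop)
    (qUp qLeft : Option (Window Q)) (a : Γ) (w : Window Q) : Prop where
  cell : R [w.cellLeft, w.cellUp] (some a) [w.cellDown, w.cellRight]
  top_left : qUp = none → qLeft = none → R [] none [w.leftIn, w.topIn]
  top : qUp = none → R [w.topIn] none [w.cellUp, w.topOut]
  top_right : w.lastCol = true → qUp = none → R [w.topOut] none [w.rightIn]
  left : qLeft = none → R [w.leftIn] none [w.leftOut, w.cellLeft]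
  right : w.lastCol = true → R [w.cellRight, w.rightIn] none [w.rightOut]
  bottom_left : w.lastRow = true → qLeft = none → R [w.leftOut] none [w.bottomIn]
  bottom : w.lastRow = true → R [w.bottomIn, w.cellDown] none [w.bottomOut]
  of_up : ∀ u, qUp = some u → w.cellUp = u.cellDown ∧ w.leftIn = u.leftOut ∧
    w.rightIn = u.rightOut ∧ w.lastCol = u.lastCol
  of_left : ∀ l, qLeft = some l → w.cellLeft = l.cellRight ∧ w.topIn = l.topOut ∧
    w.bottomIn = l.bottomOut ∧ w.lastRow = l.lastRow

/-- The empty picture. -/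
def emptyPicture (Γ : Type u) : Picture Γ where
  rows := 0
  cols := 0
  rows_eq_zero_iff := Iff.rfl
  cell i := i.elim0

theorem Picture.eq_emptyPicture {Γ : Type u} (P : Picture Γ) (h : P.rows = 0) :
    P = emptyPicture Γ := by
  obtain ⟨m, n, hmn, c⟩ := P
  obtain rfl : m = 0 := h
  obtain rfl : n = 0 := hmn.1 rfl
  have : c = fun i => i.elim0 := funext fun i => i.elim0
  subst this
  rfl

/-- The 2OTA that simulates the DAG automaton `A` on the encodings of pictures. -/
def DAGAutomaton.toTwoOTA {Γ : Type u} (A : DAGAutomaton (Option Γ)) : TwoOTA Γ where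
  State := Option (Window A.State)
  finite_state := by
    have := A.finite_state
    have := Window.finite (Q := A.State)
    infer_instance
  init := none
  final := {s | (s = none ∧ cooEnc (emptyPicture Γ) ∈ A.language) ∨
    ∃ w, s = some w ∧ w.lastRow = true ∧ w.lastCol = true ∧
      A.HasRule [w.bottomOut, w.rightOut] none []}
  step up left a := {s | ∃ w, s = some w ∧ w.IsStep A.HasRule up left a}

/-- All guesses are read off the run. The border edges of a window depend on its row index alone or
on its column index alone, so neighbouring windows agree on them. -/
theorem DAGAutomaton.exists_isGridRun_toTwoOTA {Γ : Type u} (A : DAGAutomaton (Option Γ))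
    (P : Picture Γ) (hP : 0 < P.rows) {h v : ℕ → ℕ → A.State}
    (H : IsGridRun A.HasRule P h v) : ∃ q, A.toTwoOTA.IsGridRun P q := by
  let w : ℕ → ℕ → Window A.State := fun i j =>
    { topIn := h 0 j
      topOut := h 0 (j + 1)
      cellLeft := h (i + 1) j
      cellRight := h (i + 1) (j + 1)
      bottomIn := h (P.rows + 1) j
      bottomOut := h (P.rows + 1) (j + 1)
      leftIn := v i 0
      leftOut := v (i + 1) 0
      cellUp := v i (j + 1)
      cellDown := v (i + 1) (j + 1)
      rightIn := v i (P.cols + 1)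
      rightOut := v (i + 1) (P.cols + 1)
      lastRow := decide (i + 1 = P.rows)
      lastCol := decide (j + 1 = P.cols) }
  let q : ℕ → ℕ → Option (Window A.State) := fun i j =>
    match i, j with
    | i + 1, j + 1 => some (w i j)
    | _, _ => none
  have hP' : 0 < P.cols := by
    have := P.rows_eq_zero_iff
    omega
  have hq : ∀ i, q i 0 = none := by rintro (_ | _) <;> rfl
  refine ⟨q, fun _ => rfl, hq, fun i j hi hj => ⟨w i j, rfl, ?_⟩, ?_⟩
  · have up_none : q i (j + 1) = none → i = 0 := by
      rcases i with _ | i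
      · exact fun _ => rfl
      · exact fun h => nomatch h
    have left_none : q (i + 1) j = none → j = 0 := by
      rcases j with _ | j
      · exact fun _ => rfl
      · exact fun h => nomatch h
    refine ⟨H.cell i j hi hj, fun hu hl => ?_, fun hu => ?_, fun hc hu => ?_, fun hl => ?_,
      fun hc => ?_, fun hr hl => ?_, fun hr => ?_, fun u hu => ?_, fun l hl => ?_⟩
    · obtain rfl := up_none hu
      obtain rfl := left_none hl
      exact H.top_left
    · obtain rfl := up_none hu
      exact H.top j hj
    · obtain rfl := up_none hu
      have hc : j + 1 = P.cols := of_decide_eq_true hc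
      change A.HasRule [h 0 (j + 1)] none [v 0 (P.cols + 1)]
      rw [hc]
      exact H.top_right
    · obtain rfl := left_none hl
      exact H.left i hi
    · have hc : j + 1 = P.cols := of_decide_eq_true hc
      change A.HasRule [h (i + 1) (j + 1), v i (P.cols + 1)] none [v (i + 1) (P.cols + 1)]
      rw [hc]
      exact H.right i hi
    · obtain rfl := left_none hl
      have hr : i + 1 = P.rows := of_decide_eq_true hr
      change A.HasRule [v (i + 1) 0] none [h (P.rows + 1) 0]
      rw [hr]
      exact H.bottom_left
    · have hr : i + 1 = P.rows := of_decide_eq_true hr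
      change A.HasRule [h (P.rows + 1) j, v (i + 1) (j + 1)] none [h (P.rows + 1) (j + 1)]
      rw [hr]
      exact H.bottom j hj
    · rcases i with _ | i
      · exact nomatch hu
      · obtain rfl := Option.some.inj hu
        exact ⟨rfl, rfl, rfl, rfl⟩
    · rcases j with _ | j
      · exact nomatch ((hq (i + 1)).symm.trans hl)
      · obtain rfl := Option.some.inj hl
        exact ⟨rfl, rfl, rfl, rfl⟩
  · obtain ⟨i, hi⟩ := Nat.exists_eq_add_one_of_ne_zero hP.ne'
    obtain ⟨j, hj⟩ := Nat.exists_eq_add_one_of_ne_zero hP'.ne'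
    refine Or.inr ⟨w i j, by rw [hi, hj], decide_eq_true hi.symm, decide_eq_true hj.symm, ?_⟩
    change A.HasRule [h (P.rows + 1) (j + 1), v (i + 1) (P.cols + 1)] none []
    rw [← hi, ← hj]
    exact H.bottom_right

/-- The border edges are taken from the windows in the first and last rows and columns. A flag set
elsewhere only adds checks, so wrong guesses do no harm. -/
theorem DAGAutomaton.exists_gridRun {Γ : Type u} (A : DAGAutomaton (Option Γ))
    (P : Picture Γ) (hP : 0 < P.rows) {q : ℕ → ℕ → Option (Window A.State)}
    (hq : A.toTwoOTA.IsGridRun P q) : ∃ h v, IsGridRun A.HasRule P h v := by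
  obtain ⟨m, hm⟩ := Nat.exists_eq_add_one_of_ne_zero hP.ne'
  obtain ⟨n, hn⟩ := Nat.exists_eq_add_one_of_ne_zero (mt P.rows_eq_zero_iff.2 hP.ne')
  -- A default window outside the picture.
  obtain ⟨w₀, -⟩ := hq.cell 0 0 (by omega) (by omega)
  have hw : ∀ i j, ∃ w, i < P.rows → j < P.cols → q (i + 1) (j + 1) = some w := by
    intro i j
    by_cases H : i < P.rows ∧ j < P.cols
    · obtain ⟨w, hw, -⟩ := hq.cell i j H.1 H.2
      exact ⟨w, fun _ _ => hw⟩
    · exact ⟨w₀, fun hi hj => (H ⟨hi, hj⟩).elim⟩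
  choose w hw using hw
  have step : ∀ i j (hi : i < P.rows) (hj : j < P.cols), (w i j).IsStep A.HasRule
      (q i (j + 1)) (q (i + 1) j) (P.cell ⟨i, hi⟩ ⟨j, hj⟩) := by
    intro i j hi hj
    obtain ⟨w', hw', H⟩ := hq.cell i j hi hj
    obtain rfl := Option.some.inj ((hw i j hi hj).symm.trans hw')
    exact H
  have of_up := fun i j (hi : i + 1 < P.rows) (hj : j < P.cols) =>
    (step (i + 1) j hi hj).of_up _ (hw i j (by omega) hj)
  have of_left := fun i j (hi : i < P.rows) (hj : j + 1 < P.cols) =>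
    (step i (j + 1) hi hj).of_left _ (hw i j hi (by omega))
  have up_none : ∀ j, q 0 j = none := hq.first_row
  have left_none : ∀ i, q i 0 = none := hq.first_col
  obtain ⟨hr, hc, hf⟩ : (w m n).lastRow = true ∧ (w m n).lastCol = true ∧
      A.HasRule [(w m n).bottomOut, (w m n).rightOut] none [] := by
    have hf := hq.final
    have e := hw m n (by omega) (by omega)
    rw [hm, hn] at hf
    rcases hf with ⟨h, -⟩ | ⟨w', h, H⟩
    · exact nomatch (e.symm.trans h)
    · obtain rfl := Option.some.inj (e.symm.trans h)
      exact H
  -- Acceptance sets the flag at the last cell only; its constancy along the row carries it back to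
  -- all cells of that row.
  have lastRow : ∀ j, j < P.cols → (w m j).lastRow = true := by
    have key : ∀ j, j < P.cols → (w m j).lastRow = (w m 0).lastRow := by
      intro j
      induction j with
      | zero => exact fun _ => rfl
      | succ j ih => exact fun hj => (of_left m j (by omega) hj).2.2.2.trans (ih (by omega))
    exact fun j hj => (key j hj).trans ((key n (by omega)).symm.trans hr)
  have lastCol : ∀ i, i < P.rows → (w i n).lastCol = true := by
    have key : ∀ i, i < P.rows → (w i n).lastCol = (w 0 n).lastCol := by
      intro i
      induction i with
      | zero => exact fun _ => rfl
      | succ i ih => exact fun hi => (of_up i n hi (by omega)).2.2.2.trans (ih (by omega))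
    exact fun i hi => (key i hi).trans ((key m (by omega)).symm.trans hc)
  -- An edge shared by two windows is read from the left or upper one. In `h`, the test `i < P.rows`
  -- fails in the bottom border row, whose edges come from row `m` of windows; `v` is symmetric.
  let h : ℕ → ℕ → A.State := fun i j =>
    match i, j with
    | 0, 0 => (w 0 0).topIn
    | 0, j + 1 => (w 0 j).topOut
    | i + 1, 0 => if i < P.rows then (w i 0).cellLeft else (w m 0).bottomIn
    | i + 1, j + 1 => if i < P.rows then (w i j).cellRight else (w m j).bottomOut
  let v : ℕ → ℕ → A.State := fun i j =>
    match i, j with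
    | 0, 0 => (w 0 0).leftIn
    | i + 1, 0 => (w i 0).leftOut
    | 0, j + 1 => if j < P.cols then (w 0 j).cellUp else (w 0 n).rightIn
    | i + 1, j + 1 => if j < P.cols then (w i j).cellDown else (w i n).rightOut
  have h_topIn : ∀ j, j < P.cols → h 0 j = (w 0 j).topIn := by
    rintro (_ | j) hj
    · rfl
    · exact (of_left 0 j hP hj).2.1.symm
  have h_left : ∀ i j, i < P.rows → j < P.cols → h (i + 1) j = (w i j).cellLeft := by
    rintro i (_ | j) hi hj
    · exact if_pos hi
    · exact (if_pos hi).trans (of_left i j hi hj).1.symm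
  have h_right : ∀ i j, i < P.rows → h (i + 1) (j + 1) = (w i j).cellRight :=
    fun i j hi => if_pos hi
  have h_bottomIn : ∀ j, j < P.cols → h (P.rows + 1) j = (w m j).bottomIn := by
    rintro (_ | j) hj
    · exact if_neg (lt_irrefl _)
    · exact (if_neg (lt_irrefl _)).trans (of_left m j (by omega) hj).2.2.1.symm
  have h_bottomOut : ∀ j, h (P.rows + 1) (j + 1) = (w m j).bottomOut :=
    fun j => if_neg (lt_irrefl _)
  have v_leftIn : ∀ i, i < P.rows → v i 0 = (w i 0).leftIn := by
    rintro (_ | i) hi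
    · rfl
    · exact (of_up i 0 hi (by omega)).2.1.symm
  have v_up : ∀ i j, i < P.rows → j < P.cols → v i (j + 1) = (w i j).cellUp := by
    rintro (_ | i) j hi hj
    · exact if_pos hj
    · exact (if_pos hj).trans (of_up i j hi hj).1.symm
  have v_down : ∀ i j, j < P.cols → v (i + 1) (j + 1) = (w i j).cellDown :=
    fun i j hj => if_pos hj
  have v_rightIn : ∀ i, i < P.rows → v i (P.cols + 1) = (w i n).rightIn := by
    rintro (_ | i) hi
    · exact if_neg (lt_irrefl _)
    · exact (if_neg (lt_irrefl _)).trans (of_up i n hi (by omega)).2.2.1.symm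
  have v_rightOut : ∀ i, v (i + 1) (P.cols + 1) = (w i n).rightOut :=
    fun i => if_neg (lt_irrefl _)
  have hm' : m < P.rows := by omega
  have hn' : n < P.cols := by omega
  have hP' : 0 < P.cols := by omega
  -- The matches defining `h` and `v` reduce at successors only, so the indices `P.rows` and
  -- `P.cols` are rewritten as `m + 1` and `n + 1`.
  have h_top_last : h 0 P.cols = (w 0 n).topOut := by rw [hn]
  have h_right_last : ∀ i, i < P.rows → h (i + 1) P.cols = (w i n).cellRight := fun i hi => by
    rw [← h_right i n hi, hn]
  have h_bottom_last : h (P.rows + 1) P.cols = (w m n).bottomOut := by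
    rw [← h_bottomOut n, hn]
  have v_left_last : v P.rows 0 = (w m 0).leftOut := by rw [hm]
  have v_down_last : ∀ j, j < P.cols → v P.rows (j + 1) = (w m j).cellDown := fun j hj => by
    rw [← v_down m j hj, hm]
  have v_right_last : v P.rows (P.cols + 1) = (w m n).rightOut := by
    rw [← v_rightOut m, hm]
  refine ⟨h, v, ?_, fun j hj => ?_, ?_, fun i hi => ?_, fun i j hi hj => ?_, fun i hi => ?_, ?_,
    fun j hj => ?_, ?_⟩
  · exact (step 0 0 hP hP').top_left (up_none _) (left_none _)
  · rw [h_topIn j hj, v_up 0 j hP hj]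
    exact (step 0 j hP hj).top (up_none _)
  · rw [h_top_last, v_rightIn 0 hP]
    exact (step 0 n hP hn').top_right (lastCol 0 hP) (up_none _)
  · rw [v_leftIn i hi, h_left i 0 hi hP']
    exact (step i 0 hi hP').left (left_none _)
  · rw [h_left i j hi hj, v_up i j hi hj, v_down i j hj, h_right i j hi]
    exact (step i j hi hj).cell
  · rw [h_right_last i hi, v_rightIn i hi, v_rightOut]
    exact (step i n hi hn').right (lastCol i hi)
  · rw [v_left_last, h_bottomIn 0 hP']
    exact (step m 0 hm' hP').bottom_left (lastRow 0 hP') (left_none _)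
  · rw [h_bottomIn j hj, v_down_last j hj, h_bottomOut]
    exact (step m j hm' hj).bottom (lastRow j hj)
  · rw [h_bottom_last, v_right_last]
    exact hf

/-- On the empty picture, acceptance depends only on whether `none` is final, which was defined to
give the right answer. On other pictures the last cell carries a window, so that clause has no
effect. -/
theorem DAGAutomaton.mem_toTwoOTA_language_iff {Γ : Type u} (A : DAGAutomaton (Option Γ))
    (P : Picture Γ) : P ∈ A.toTwoOTA.language ↔ cooEnc P ∈ A.language := by
  refine (A.toTwoOTA.accepts_iff P).trans ?_
  rcases Nat.eq_zero_or_pos P.rows with hP | hP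
  · obtain rfl := P.eq_emptyPicture hP
    constructor
    · rintro ⟨q, hq⟩
      rcases hq.final with ⟨-, h⟩ | ⟨w, hw, -⟩
      · exact h
      · exact nomatch ((hq.first_row 0).symm.trans hw)
    · exact fun h => ⟨fun _ _ => none, fun _ => rfl, fun _ => rfl,
        fun i _ hi => (i.not_lt_zero hi).elim, Or.inl ⟨rfl, h⟩⟩
  · rw [A.cooEnc_mem_language_iff]
    constructor
    · rintro ⟨q, hq⟩
      exact A.exists_gridRun P hP hq
    · rintro ⟨h, v, H⟩
      exact A.exists_isGridRun_toTwoOTA P hP H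

end PicDAG

/-! ### Equivalence of the two families -/

theorem mainTheorem2 (Γ : Type u) [Finite Γ] :
    PicDAG.FamiliesEquivalent PicDAG.cooEnc
      (Set.univ : Set (PicDAG.DAGAutomaton (Option Γ))) (Set.univ : Set (PicDAG.TwoOTA Γ)) ∧
    ∀ L : Set (PicDAG.Picture Γ),
      (∃ M : PicDAG.TwoOTA Γ, M.language = L) ↔
        (∃ A : PicDAG.DAGAutomaton (Option Γ), {P | PicDAG.cooEnc P ∈ A.language} = L) := by
  have hA : ∀ A : PicDAG.DAGAutomaton (Option Γ),
      A.toTwoOTA.language = PicDAG.cooEnc ⁻¹' A.language :=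
    fun A => Set.ext A.mem_toTwoOTA_language_iff
  have hM : ∀ M : PicDAG.TwoOTA Γ, PicDAG.cooEnc ⁻¹' M.toDAGAutomaton.language = M.language :=
    fun M => Set.ext M.cooEnc_mem_toDAGAutomaton_language_iff
  refine ⟨fun L => ⟨?_, ?_⟩, fun L => ⟨?_, ?_⟩⟩
  · rintro ⟨A, -, rfl⟩
    -- The image of a preimage is the intersection with the range, so injectivity of the encoding is
    -- not needed.
    exact ⟨A.toTwoOTA, trivial, by rw [hA, Set.image_preimage_eq_inter_range]⟩
  · rintro ⟨M, -, rfl⟩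
    exact ⟨M.toDAGAutomaton, trivial, by rw [← hM, Set.image_preimage_eq_inter_range]⟩
  · rintro ⟨M, rfl⟩
    exact ⟨M.toDAGAutomaton, hM M⟩
  · rintro ⟨A, rfl⟩
    exact ⟨A.toTwoOTA, hA A⟩
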